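/- Finite and infinite words are over finite alphabets. For a finite word $v$ and a non-empty finite word $u$, write $v=u^e$ if $v$ is a prefix of the infinite periodic word $uuu\cdots$ and $e=|v|/|u|$. The critical exponent of an infinite word $\mathbf w$ is $$E(\mathbf w)=\sup\{e\in\mathbb Q:\ u^e \text{ is a factor of } \mathbf w \text{ for some non-empty word } u\}\in[0,+\infty].$$ Let $\varphi$ be the morphism $\mathtt 0\mapsto\mathtt{01}$, $\mathtt 1\mapsto\mathtt{21}$, $\mathtt 2\mapsto\mathtt 0$, and let $\mathbf p=\varphi^\omega(\mathtt 0)=\mathtt{01210210102}\cdots$ be its unique infinite fixed point, that is, the infinite word that has every $\varphi^n(\mathtt 0)$ as a prefix. Let $\mu$ be the morphism $\mathtt 0\mapsto\mathtt{011001}$, $\mathtt 1\mapsto\mathtt{1001}$, $\mathtt 2\mapsto\mathtt 0$, and let $\mu(\mathbf p)=\mu(p_0)\mu(p_1)\mu(p_2)\cdots$. Then $$E(\mu(\mathbf p))=\frac{28}{11}.$$ -/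

import Mathlib

/-! Finite words over `α` are lists, infinite words are functions `ℕ → α`, and a morphism of free
monoids is given by the images of the letters. -/

namespace InfWord

/-- The factor of length `n` that starts at position `k` of the infinite word `u`. -/
def factorAt {α : Type*} (u : ℕ → α) (k n : ℕ) : List α :=
  (List.range n).map fun i => u (k + i)

/-- The finite word `v` is a factor of the infinite word `u`. -/
def IsFactor {α : Type*} (v : List α) (u : ℕ → α) : Prop :=
  ∃ k : ℕ, v = factorAt u k v.length

/-- The finite word `v` is a prefix of the infinite word `u`. -/
def IsPrefixOf {α : Type*} (v : List α) (u : ℕ → α) : Prop :=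
  v = factorAt u 0 v.length

/-- The infinite periodic word `u u u ⋯` for a non-empty word `u`. -/
def omegaPower {α : Type*} (u : List α) (hu : u ≠ []) : ℕ → α :=
  fun i => u[i % u.length]'(Nat.mod_lt i (List.length_pos_iff.mpr hu))

/-- `v = u ^ e`: the word `v` is a prefix of `u u u ⋯` and `e = |v| / |u|`. -/
def IsPower {α : Type*} (v u : List α) (hu : u ≠ []) (e : ℚ) : Prop :=
  IsPrefixOf v (omegaPower u hu) ∧ e = (v.length : ℚ) / (u.length : ℚ)

/-- The critical exponent of an infinite word, in the extended reals (it may be `+∞`): the supremum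
of the rational numbers `e` such that `u ^ e` is a factor of `w` for a non-empty word `u`. -/
noncomputable def criticalExponent {α : Type*} (w : ℕ → α) : EReal :=
  sSup {x : EReal | ∃ e : ℚ, x = ((e : ℝ) : EReal) ∧
    ∃ (u : List α) (hu : u ≠ []) (v : List α), IsPower v u hu e ∧ IsFactor v w}

/-- The action of a morphism on finite words. -/
def applyMor {α β : Type*} (ψ : α → List β) (v : List α) : List β :=
  v.flatMap ψ

theorem length_le_length_applyMor {α β : Type*} (ψ : α → List β) (hψ : ∀ a, ψ a ≠ [])
    (v : List α) : v.length ≤ (applyMor ψ v).length := by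
  induction v with
  | nil => simp
  | cons a v ih =>
    have := List.length_pos_iff.mpr (hψ a)
    simp only [applyMor, List.flatMap_cons, List.length_append, List.length_cons] at ih ⊢
    omega

/-- The infinite word `ψ(u₀) ψ(u₁) ψ(u₂) ⋯` for a non-erasing morphism `ψ`: its letter at position
`n` is read off from `ψ(u₀ ⋯ uₙ)`, whose length is at least `n + 1`. -/
def image {α β : Type*} (ψ : α → List β) (hψ : ∀ a, ψ a ≠ []) (u : ℕ → α) : ℕ → β :=
  fun n => (applyMor ψ (factorAt u 0 (n + 1)))[n]'(by
    have := length_le_length_applyMor ψ hψ (factorAt u 0 (n + 1))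
    simp only [factorAt, List.length_map, List.length_range] at this ⊢
    omega)

theorem applyMor_append {α β : Type*} (ψ : α → List β) (v w : List α) :
    applyMor ψ (v ++ w) = applyMor ψ v ++ applyMor ψ w := by
  simp [applyMor]

theorem factorAt_zero_prefix {α : Type*} (u : ℕ → α) {m n : ℕ} (h : m ≤ n) :
    factorAt u 0 m <+: factorAt u 0 n := by
  obtain ⟨k, rfl⟩ := Nat.exists_eq_add_of_le h
  exact ⟨(List.range k).map fun i => u (0 + (m + i)), by
    simp [factorAt, List.range_add, List.map_append]⟩

theorem applyMor_prefix {α β : Type*} (ψ : α → List β) {v w : List α} (h : v <+: w) :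
    applyMor ψ v <+: applyMor ψ w := by
  obtain ⟨t, rfl⟩ := h
  exact ⟨applyMor ψ t, (applyMor_append ψ v t).symm⟩

theorem isPrefixOf_iff {α : Type*} (v : List α) (u : ℕ → α) :
    IsPrefixOf v u ↔ ∀ (i : ℕ) (h : i < v.length), v[i] = u i := by
  unfold IsPrefixOf
  rw [List.ext_getElem_iff]
  simp [factorAt]

/-- The defining property of `image`: it has every `ψ(u₀ ⋯ uₙ₋₁)` as a prefix. -/
theorem applyMor_isPrefixOf_image {α β : Type*} (ψ : α → List β) (hψ : ∀ a, ψ a ≠ [])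
    (u : ℕ → α) (n : ℕ) : IsPrefixOf (applyMor ψ (factorAt u 0 n)) (image ψ hψ u) := by
  rw [isPrefixOf_iff]
  intro i hi
  unfold image
  rcases le_total n (i + 1) with h | h
  · exact (applyMor_prefix ψ (factorAt_zero_prefix u h)).getElem hi
  · exact ((applyMor_prefix ψ (factorAt_zero_prefix u h)).getElem _).symm

/-- `0 → 01`, `1 → 21`, `2 → 0`. -/
def phi : Fin 3 → List (Fin 3)
  | 0 => [0, 1]
  | 1 => [2, 1]
  | 2 => [0]

theorem phi_ne_nil (a : Fin 3) : phi a ≠ [] := by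
  fin_cases a <;> simp [phi]

/-- `0 → 011001`, `1 → 1001`, `2 → 0`. -/
def mu : Fin 3 → List (Fin 2)
  | 0 => [0, 1, 1, 0, 0, 1]
  | 1 => [1, 0, 0, 1]
  | 2 => [0]

theorem mu_ne_nil (a : Fin 3) : mu a ≠ [] := by
  fin_cases a <;> simp [mu]

theorem iterate_phi_append (n : ℕ) (v w : List (Fin 3)) :
    (applyMor phi)^[n] (v ++ w) = (applyMor phi)^[n] v ++ (applyMor phi)^[n] w := by
  induction n generalizing v w with
  | zero => rfl
  | succ n ih => simp only [Function.iterate_succ_apply, applyMor_append, ih]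

theorem iterate_phi_succ (n : ℕ) :
    (applyMor phi)^[n + 1] [0] = (applyMor phi)^[n] [0] ++ (applyMor phi)^[n] [1] :=
  iterate_phi_append n [0] [1]

theorem length_le_length_iterate_phi (n : ℕ) (v : List (Fin 3)) :
    v.length ≤ ((applyMor phi)^[n] v).length := by
  induction n generalizing v with
  | zero => exact le_rfl
  | succ n ih => exact (length_le_length_applyMor phi phi_ne_nil v).trans (ih _)

theorem lt_length_iterate_phi (n : ℕ) : n < ((applyMor phi)^[n] [0]).length := by
  induction n with
  | zero => simp
  | succ n ih =>
    have h := length_le_length_iterate_phi n [1]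
    rw [iterate_phi_succ, List.length_append]
    simp only [List.length_singleton] at h
    omega

/-- The infinite word `p`, the limit of the words `φⁿ(0)`, each of which is a prefix of the
next one; `φⁿ(0)` has more than `n` letters. -/
def p : ℕ → Fin 3 :=
  fun n => ((applyMor phi)^[n] [0])[n]'(lt_length_iterate_phi n)

theorem iterate_phi_prefix {m n : ℕ} (h : m ≤ n) :
    (applyMor phi)^[m] [0] <+: (applyMor phi)^[n] [0] := by
  induction n, h using Nat.le_induction with
  | base => exact List.prefix_rfl
  | succ n _ ih => exact ih.trans ⟨_, (iterate_phi_succ n).symm⟩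

theorem iterate_phi_isPrefixOf_p (n : ℕ) : IsPrefixOf ((applyMor phi)^[n] [0]) p := by
  rw [isPrefixOf_iff]
  intro i hi
  unfold p
  rcases le_total n i with h | h
  · exact (iterate_phi_prefix h).getElem hi
  · exact ((iterate_phi_prefix h).getElem _).symm

/-- A fixed point of `φ` has every `φⁿ(0)` as a prefix. -/
theorem iterate_phi_isPrefixOf_of_fixed (u : ℕ → Fin 3) (hu : image phi phi_ne_nil u = u) (n : ℕ) :
    IsPrefixOf ((applyMor phi)^[n] [0]) u := by
  induction n with
  | zero =>
    have key : ∀ a : Fin 3, (phi a)[0]'(List.length_pos_iff.mpr (phi_ne_nil a)) = a → a = 0 := by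
      intro a
      fin_cases a <;> simp [phi]
    have h0 : u 0 = 0 := by
      apply key
      have h := congrFun hu 0
      simpa [image, factorAt, applyMor] using h
    simp [isPrefixOf_iff, h0]
  | succ n ih =>
    rw [Function.iterate_succ_apply']
    rw [IsPrefixOf] at ih
    rw [ih]
    have := applyMor_isPrefixOf_image phi phi_ne_nil u ((applyMor phi)^[n] [0]).length
    rwa [hu] at this

/-- The word `p` is a fixed point of `φ`. -/
theorem image_phi_p : image phi phi_ne_nil p = p := by
  funext n
  have h1 := iterate_phi_isPrefixOf_p n
  have h2 := applyMor_isPrefixOf_image phi phi_ne_nil p ((applyMor phi)^[n] [0]).length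
  rw [IsPrefixOf] at h1
  rw [← h1, ← Function.iterate_succ_apply' (applyMor phi), isPrefixOf_iff] at h2
  have h3 := (isPrefixOf_iff _ _).1 (iterate_phi_isPrefixOf_p (n + 1))
  have hn := (Nat.lt_succ_self n).trans (lt_length_iterate_phi (n + 1))
  rw [← h2 n hn, ← h3 n hn]

/-- The word `p` is the only fixed point of `φ`. -/
theorem eq_p_of_fixed (u : ℕ → Fin 3) (hu : image phi phi_ne_nil u = u) : u = p := by
  funext n
  rw [← (isPrefixOf_iff _ _).1 (iterate_phi_isPrefixOf_of_fixed u hu n) n (lt_length_iterate_phi n)]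
  rfl

end InfWord

/-! A factor of length `q + m` with period `q` has exponent `1 + m / q`, so the upper bound amounts
to `11 * m ≤ 17 * q` for every repetition of `μ(p)`. Small periods are settled by computation; large
ones are pulled back to `p`.

The computations are finite because `p` has only five factors of length two, all starting at its
first five positions. Hence every window that is short compared with the images of letters under a
power of `φ` (or `μ` after such a power) recurs near the origin.

The images under `μ ∘ φ` all start with `01` and end with `001`, and `00101` occurs in `μ(p)` only
across their boundaries. A long repetition of `μ(p)` is therefore the image of a repetition of `p`,
apart from at most 6 letters at each end (`HasRepetition.muP_desubstitute`). It remains to bound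
repetitions of `p` in the lengths of their images, with 12 letters to spare.

Since `φ` is not uniform, lengths alone do not pass through the induction. The invariant is one
inequality per letter `c`: if `c` occurs `M` times in the first `m` letters of the repetition and
`Q` times in its first `q` letters, then `11 * (M + 1) ≤ 17 * Q`. Applying `φ` adds such
inequalities, and their slack pays for the letters lost at the ends (`HasRepetition.bound`). Periods
38 to 75 are the computed base; smaller periods of `p` are checked directly for image lengths.

The value is attained by a factor of length 28 and period 11. -/

namespace InfWord

/-! ### Finite words as base 4 numerals -/

/-- The base 4 digit of `W` at position `i`. -/
def digit (W i : ℕ) : ℕ := Nat.mod (Nat.div W (Nat.pow 4 i)) 4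

/-- The number of `i < n` for which the base 4 digit of `W` at position `t + i` is `c`. -/
def digitCount (W c t : ℕ) : ℕ → ℕ
  | 0 => 0
  | n + 1 => digitCount W c t n + bif Nat.beq (digit W (Nat.add t n)) c then 1 else 0

/-- Test `P` at the first mismatch between the digits of `W` from `t` on and from `t + q` on, which
has to be found within `fuel` digits; `i` digits have been compared already. -/
def testAtMismatch (W t q : ℕ) (P : ℕ → Bool) : ℕ → ℕ → Bool
  | 0, _ => false
  | fuel + 1, i =>
    bif Nat.beq (digit W (Nat.add t i)) (digit W (Nat.add (Nat.add t q) i)) then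
      testAtMismatch W t q P fuel (Nat.succ i)
    else P i

/-- `P` holds for all numbers below a bound. -/
def allBelow (P : ℕ → Bool) : ℕ → Bool
  | 0 => true
  | n + 1 => P n && allBelow P n

/-- The prefix `φ¹³(0)` of `p`. -/
def pCode : ℕ := 0x1846461918461918464611864611918646119184619184646191846191846461918464611864611918646118646119184619184646191846191846461918464611864611918646118646119184619184646191846461186461191864611864611918461918464619184619184646191846461186461191864611864611918461918464619184646118646119186461186461191864611918461918464619184619184646118646119186461191846191846461918461918464611864611918646118646119186461191846191846461918461918464611864611918646119184619184646191846191846461918464611864611918646118646119184619184646191846191846461918464611864611918646118646119184619184646191846461186461191864611864611918461918464619184619184646191846461186461191864611864611918461918464619184646118646119186461186461191864611918461918464619184619184646118646119186461186461191864611918461918464619184619184646118646119186461191846191846461918461918464619184646118646119186461186461191846191846461918464611864611918646118646119184619184646191846191846461918464611864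

/-- The prefix `μ(φ¹⁰(0))` of `μ(p)`. -/
def muCode : ℕ := 0x411051050510441414411051044141441105105051044144110505104414414144110505104414414144110510441414411051050510441414411051044141441105105051044141441105105051044144110505104414414144110505104414411050510441441414411051044141441105105051044141441105104414144110510505104414144110510505104414411050510441441414411050510441441105051044144141441105104414144110510505104414144110510505104414411050510441441414411050510441441105051044144141441105051044144141441105104414144110510505104414144110510441414411051050510441441105051044144141441105051044144141441105104414144110510505104414144110510441414411051050510441441105051044144141441105051044144110505104414414144110505104414414144110510441414

theorem ofDigits_iterate_phi :
    Nat.ofDigits 4 (((applyMor phi)^[13] [0]).map Fin.val) = pCode := by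
  decide +kernel

theorem ofDigits_applyMor_mu :
    Nat.ofDigits 4 ((applyMor mu ((applyMor phi)^[10] [0])).map Fin.val) = muCode := by
  decide +kernel

/-- The length of the image under `μ ∘ φ` of a word of length `n` at position `t` of `p`. -/
def digitWeight (W t n : ℕ) : ℕ :=
  10 * digitCount W 0 t n + 5 * digitCount W 1 t n + 6 * digitCount W 2 t n

/-- The bound on repetitions of period `q < 38` and length `q + m` in `p`. -/
def shortBound (W t q m : ℕ) : Bool :=
  (Nat.ble 5 q && Nat.ble m q) || Nat.blt (digitWeight W t q) 48 ||
    Nat.ble (11 * (digitWeight W t m + 12)) (17 * digitWeight W t q)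

/-- The bound on repetitions of period `q ≥ 38` and length `q + m` in `p`. -/
def longBound (W t q m : ℕ) : Bool :=
  Nat.ble m q || allBelow (fun c =>
    Nat.ble (11 * (digitCount W c t m + 1)) (17 * digitCount W c t q)) 3

theorem two_le_digitCount_pCode :
    allBelow (fun t => allBelow (fun c => Nat.ble 2 (digitCount pCode c t 9)) 3) 86 = true := by
  decide +kernel

theorem shortBound_pCode : allBelow (fun t => allBelow (fun q =>
    testAtMismatch pCode t (q + 1) (shortBound pCode t (q + 1)) 77 0) 37) 816 = true := by
  decide +kernel

/-- The periods run through 38 to 75, a full doubling range: since `φ` at most doubles lengths,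
desubstituting a period of at least 76 gives one of at least 38. -/
theorem longBound_pCode : allBelow (fun t => allBelow (fun q =>
    testAtMismatch pCode t (q + 38) (longBound pCode t (q + 38)) 125 0) 38) 1432 = true := by
  decide +kernel

theorem bound_muCode : allBelow (fun t => allBelow (fun q =>
    testAtMismatch muCode t (q + 1) (fun m => Nat.ble (11 * m) (17 * (q + 1))) 98 0) 47) 1037
      = true := by
  decide +kernel

/-! ### Images of infinite words under morphisms -/

section Image

variable {α β γ : Type*}

/-- `w` has every `χ(u₀ ⋯ uₙ₋₁)` as a prefix. -/
def IsImage (χ : α → List β) (u : ℕ → α) (w : ℕ → β) : Prop :=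
  ∀ n, IsPrefixOf (applyMor χ (factorAt u 0 n)) w

/-- The position at which the image of the letter at position `k` starts. -/
def start (χ : α → List β) (u : ℕ → α) (k : ℕ) : ℕ :=
  (applyMor χ (factorAt u 0 k)).length

theorem factorAt_succ (u : ℕ → α) (k n : ℕ) :
    factorAt u k (n + 1) = factorAt u k n ++ [u (k + n)] := by
  simp [factorAt, List.range_succ]

@[simp]
theorem start_zero (χ : α → List β) (u : ℕ → α) : start χ u 0 = 0 := by
  simp [start, factorAt, applyMor]

theorem start_succ (χ : α → List β) (u : ℕ → α) (k : ℕ) :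
    start χ u (k + 1) = start χ u k + (χ (u k)).length := by
  simp [start, factorAt_succ, applyMor]

theorem start_strictMono {χ : α → List β} (hχ : ∀ a, χ a ≠ []) (u : ℕ → α) :
    StrictMono (start χ u) := by
  refine strictMono_nat_of_lt_succ fun k => ?_
  rw [start_succ]
  have := List.length_pos_iff.mpr (hχ (u k))
  omega

theorem exists_start_le_lt {χ : α → List β} (hχ : ∀ a, χ a ≠ []) (u : ℕ → α) (t : ℕ) :
    ∃ k, start χ u k ≤ t ∧ t < start χ u (k + 1) := by
  have hmono := start_strictMono hχ u
  induction t with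
  | zero =>
    refine ⟨0, by simp, ?_⟩
    exact (Nat.zero_le _).trans_lt (hmono (Nat.lt_succ_self 0))
  | succ t ih =>
    obtain ⟨k, h1, h2⟩ := ih
    rcases Nat.lt_or_ge (t + 1) (start χ u (k + 1)) with h | h
    · exact ⟨k, by omega, h⟩
    · exact ⟨k + 1, h, by have := hmono (Nat.lt_succ_self (k + 1)); simp at this; omega⟩

theorem IsImage.apply_start_add {χ : α → List β} {u : ℕ → α} {w : ℕ → β} (h : IsImage χ u w)
    (k : ℕ) {i : ℕ} (hi : i < (χ (u k)).length) : w (start χ u k + i) = (χ (u k))[i] := by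
  have h1 := (isPrefixOf_iff _ _).1 (h (k + 1)) (start χ u k + i)
    (by change _ < start χ u (k + 1); rw [start_succ]; omega)
  rw [← h1]
  simp [factorAt_succ, applyMor, start]

theorem IsImage.apply_start_add_pair {χ : α → List β} {u : ℕ → α} {w : ℕ → β}
    (h : IsImage χ u w) (k : ℕ) {i : ℕ} (hi : i < (χ (u k) ++ χ (u (k + 1))).length) :
    w (start χ u k + i) = (χ (u k) ++ χ (u (k + 1)))[i] := by
  rcases Nat.lt_or_ge i (χ (u k)).length with h1 | h1
  · rw [List.getElem_append_left h1]
    exact h.apply_start_add k h1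
  · rw [List.getElem_append_right h1,
      ← h.apply_start_add (k + 1) (by rw [List.length_append] at hi; omega), start_succ]
    congr 1
    omega

theorem isImage_image (χ : α → List β) (hχ : ∀ a, χ a ≠ []) (u : ℕ → α) :
    IsImage χ u (image χ hχ u) :=
  applyMor_isPrefixOf_image χ hχ u

theorem applyMor_applyMor (χ : α → List β) (ψ : β → List γ) (v : List α) :
    applyMor ψ (applyMor χ v) = applyMor (fun a => applyMor ψ (χ a)) v := by
  simp [applyMor, List.flatMap_assoc]

theorem IsImage.comp {χ : α → List β} {ψ : β → List γ} {u : ℕ → α} {v : ℕ → β} {w : ℕ → γ}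
    (h : IsImage χ u v) (h' : IsImage ψ v w) : IsImage (fun a => applyMor ψ (χ a)) u w := by
  intro n
  rw [← applyMor_applyMor, show applyMor χ (factorAt u 0 n) = _ from h n]
  exact h' _

end Image

theorem isImage_phi_p : IsImage phi p p := by
  have := isImage_image phi phi_ne_nil p
  rwa [image_phi_p] at this

/-- The morphism `φⁿ`. -/
def phiIter (n : ℕ) (a : Fin 3) : List (Fin 3) := (applyMor phi)^[n] [a]

theorem phiIter_ne_nil (n : ℕ) (a : Fin 3) : phiIter n a ≠ [] := by
  have := length_le_length_iterate_phi n [a]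
  exact List.length_pos_iff.mp (by simpa [phiIter, Nat.lt_iff_add_one_le] using this)

theorem isImage_phiIter_p (n : ℕ) : IsImage (phiIter n) p p := by
  induction n with
  | zero =>
    intro n
    have h0 : phiIter 0 = fun a => [a] := rfl
    have h1 : applyMor (phiIter 0) (factorAt p 0 n) = factorAt p 0 n := by
      simp [h0, applyMor]
    rw [h1, IsPrefixOf]
    simp [factorAt]
  | succ n ih =>
    have := ih.comp isImage_phi_p
    convert this using 2 with a
    simp [phiIter, Function.iterate_succ_apply']

/-- The word `μ(p)`. -/
def muP : ℕ → Fin 2 := image mu mu_ne_nil p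

theorem isImage_mu_phiIter (n : ℕ) : IsImage (fun a => applyMor mu (phiIter n a)) p muP :=
  (isImage_phiIter_p n).comp (isImage_image mu mu_ne_nil p)

theorem applyMor_mu_phiIter_ne_nil (n : ℕ) (a : Fin 3) : applyMor mu (phiIter n a) ≠ [] := by
  have h := length_le_length_applyMor mu mu_ne_nil (phiIter n a)
  have := List.length_pos_iff.mpr (phiIter_ne_nil n a)
  exact List.length_pos_iff.mp (by omega)

/-! ### Windows of `p` and of its images recur near the origin -/

theorem factorAt_p_six : factorAt p 0 6 = [0, 1, 2, 1, 0, 2] := by decide +kernel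

/-- The list is closed under passing to the pairs that start in the first block of `φ(a) φ(b)`, so
induction applies to the blocks containing position `i`. -/
theorem p_pair_mem (i : ℕ) :
    (p i, p (i + 1)) ∈ [((0 : Fin 3), (1 : Fin 3)), (1, 2), (2, 1), (1, 0), (0, 2)] := by
  induction i using Nat.strong_induction_on with
  | _ i ih =>
    obtain ⟨k, h1, h2⟩ := exists_start_le_lt phi_ne_nil p i
    obtain ⟨r, rfl⟩ := Nat.exists_eq_add_of_le h1
    rw [start_succ] at h2
    have hp0 : p 0 = 0 := rfl
    have hp1 : p 1 = 1 := rfl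
    have key : ∀ a b : Fin 3,
        (a, b) ∈ [((0 : Fin 3), (1 : Fin 3)), (1, 2), (2, 1), (1, 0), (0, 2)] →
        ∀ r : Fin 2, r.val < (phi a).length →
        ((phi a ++ phi b)[r.val]?, (phi a ++ phi b)[r.val + 1]?) ∈
          [(some (0 : Fin 3), some (1 : Fin 3)), (some 1, some 2), (some 2, some 1),
            (some 1, some 0), (some 0, some 2)] := by decide
    have hpair : (p k, p (k + 1)) ∈
        [((0 : Fin 3), (1 : Fin 3)), (1, 2), (2, 1), (1, 0), (0, 2)] := by
      rcases Nat.eq_zero_or_pos k with rfl | hk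
      · rw [hp0, hp1]; simp
      · apply ih
        -- Since `φ(0)` has two letters, block `k` starts strictly after position `k` once `k > 0`;
        -- block `0` starts at its own index and was treated apart.
        have h5 : ∀ k, k + 2 ≤ start phi p (k + 1) := by
          intro k
          induction k with
          | zero => simp [start_succ, hp0, phi]
          | succ k ih =>
            have := start_strictMono phi_ne_nil p (Nat.lt_succ_self (k + 1))
            simp only [Nat.succ_eq_add_one] at this
            omega
        obtain ⟨l, rfl⟩ := Nat.exists_eq_add_of_lt hk
        have := h5 l
        simp only [Nat.zero_add] at *
        omega
    have hlen : ∀ a, 1 ≤ (phi a).length ∧ (phi a).length ≤ 2 := by decide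
    have hla := hlen (p k)
    have hlb := hlen (p (k + 1))
    have := key _ _ hpair ⟨r, by omega⟩ (by simp; omega)
    simp only at this
    rw [List.getElem?_eq_getElem (by rw [List.length_append]; omega),
      List.getElem?_eq_getElem (by rw [List.length_append]; omega),
      ← isImage_phi_p.apply_start_add_pair k, ← isImage_phi_p.apply_start_add_pair k] at this
    simpa [Nat.add_assoc] using this

theorem exists_lt_five_pair_eq (i : ℕ) : ∃ j < 5, p i = p j ∧ p (i + 1) = p (j + 1) := by
  have h := p_pair_mem i
  have h6 := factorAt_p_six
  simp only [factorAt, List.range_succ, List.range_zero] at h6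
  simp at h6
  obtain ⟨h0, h1, h2, h3, h4, h5⟩ := h6
  simp only [List.mem_cons, Prod.mk.injEq, List.not_mem_nil, or_false] at h
  rcases h with h | h | h | h | h
  · exact ⟨0, by simp [*]⟩
  · exact ⟨1, by simp [*]⟩
  · exact ⟨2, by simp [*]⟩
  · exact ⟨3, by simp [*]⟩
  · exact ⟨4, by simp [*]⟩

/-- A window that starts inside `χ(a)` and is at most one letter longer than the next block `χ(b)`
stays inside `χ(a) χ(b)`, and the pair `ab` already occurs at one of the first five positions of
`p`. -/
theorem IsImage.exists_window {β : Type*} {χ : Fin 3 → List β} {w : ℕ → β} (h : IsImage χ p w)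
    (hχ : ∀ a, χ a ≠ []) {n : ℕ} (hn : ∀ a, n ≤ (χ a).length + 1) (k : ℕ) :
    ∃ t < (applyMor χ [0, 1, 2, 1, 0]).length, ∀ i < n, w (k + i) = w (t + i) := by
  obtain ⟨l, h1, h2⟩ := exists_start_le_lt hχ p k
  obtain ⟨r, rfl⟩ := Nat.exists_eq_add_of_le h1
  obtain ⟨j, hj, hj1, hj2⟩ := exists_lt_five_pair_eq l
  rw [start_succ] at h2
  have h5 : start χ p 5 = (applyMor χ [0, 1, 2, 1, 0]).length := by
    have : factorAt p 0 5 = [0, 1, 2, 1, 0] := by decide +kernel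
    rw [start, this]
  have hle := (start_strictMono hχ p).monotone (show j + 1 ≤ 5 from hj)
  rw [start_succ, ← hj1, h5] at hle
  refine ⟨start χ p j + r, by omega, fun i hi => ?_⟩
  have := hn (p (l + 1))
  have hlen : r + i < (χ (p l) ++ χ (p (l + 1))).length := by
    rw [List.length_append]; omega
  rw [Nat.add_assoc, Nat.add_assoc, h.apply_start_add_pair l hlen,
    h.apply_start_add_pair j (by rwa [← hj1, ← hj2])]
  simp only [hj1, hj2]

theorem exists_window_p_ten (k : ℕ) : ∃ t < 1432, ∀ i < 201, p (k + i) = p (t + i) := by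
  have h := (isImage_phiIter_p 10).exists_window (phiIter_ne_nil 10) (n := 201)
    (by decide +kernel) k
  rwa [show (applyMor (phiIter 10) [0, 1, 2, 1, 0]).length = 1432 by decide +kernel] at h

theorem exists_window_p_nine (k : ℕ) : ∃ t < 816, ∀ i < 115, p (k + i) = p (t + i) := by
  have h := (isImage_phiIter_p 9).exists_window (phiIter_ne_nil 9) (n := 115)
    (by decide +kernel) k
  rwa [show (applyMor (phiIter 9) [0, 1, 2, 1, 0]).length = 816 by decide +kernel] at h

theorem exists_window_p_five (k : ℕ) : ∃ t < 86, ∀ i < 13, p (k + i) = p (t + i) := by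
  have h := (isImage_phiIter_p 5).exists_window (phiIter_ne_nil 5) (n := 13)
    (by decide +kernel) k
  rwa [show (applyMor (phiIter 5) [0, 1, 2, 1, 0]).length = 86 by decide +kernel] at h

theorem exists_window_muP (k : ℕ) : ∃ t < 1037, ∀ i < 146, muP (k + i) = muP (t + i) := by
  have h := (isImage_mu_phiIter 7).exists_window (applyMor_mu_phiIter_ne_nil 7) (n := 146)
    (by decide +kernel) k
  rwa [show (applyMor (fun a => applyMor mu (phiIter 7 a)) [0, 1, 2, 1, 0]).length = 1037
    by decide +kernel] at h

/-! ### Soundness of the computations with numerals -/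

theorem allBelow_eq_true {P : ℕ → Bool} {n : ℕ} (h : allBelow P n = true) :
    ∀ i < n, P i = true := by
  induction n with
  | zero => simp
  | succ n ih =>
    simp only [allBelow, Bool.and_eq_true] at h
    intro i hi
    rcases Nat.lt_succ_iff_lt_or_eq.mp hi with h1 | rfl
    · exact ih h.2 i h1
    · exact h.1

theorem testAtMismatch_eq_true {W t q : ℕ} {P : ℕ → Bool} {fuel i : ℕ}
    (h : testAtMismatch W t q P fuel i = true) :
    ∃ m < i + fuel, digit W (t + m) ≠ digit W (t + q + m) ∧ P m = true := by
  induction fuel generalizing i with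
  | zero => simp [testAtMismatch] at h
  | succ fuel ih =>
    simp only [testAtMismatch, Bool.cond_eq_ite, Nat.beq_eq] at h
    split_ifs at h with h1
    · obtain ⟨m, hm, h2⟩ := ih h
      exact ⟨m, by omega, h2⟩
    · exact ⟨i, by omega, h1, h⟩

theorem digit_ofDigits (l : List ℕ) (hl : ∀ x ∈ l, x < 4) {i : ℕ} (hi : i < l.length) :
    digit (Nat.ofDigits 4 l) i = l[i] := by
  have hdef : ∀ W i, digit W i = W / 4 ^ i % 4 := fun _ _ => rfl
  induction l generalizing i with
  | nil => simp at hi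
  | cons x l ih =>
    have hx : x < 4 := hl x (by simp)
    cases i with
    | zero => rw [hdef, Nat.ofDigits_cons]; simp; omega
    | succ i =>
      have := ih (fun y hy => hl y (by simp [hy])) (i := i) (by simpa using hi)
      rw [hdef] at this ⊢
      rw [Nat.ofDigits_cons, pow_succ', ← Nat.div_div_eq_div_mul, List.getElem_cons_succ, ← this]
      congr 2
      omega

theorem digit_eq_of_isPrefixOf {n : ℕ} (hn : n ≤ 4) {v : List (Fin n)} {w : ℕ → Fin n}
    (h : IsPrefixOf v w) {W : ℕ} (hW : Nat.ofDigits 4 (v.map Fin.val) = W) {i : ℕ}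
    (hi : i < v.length) : digit W i = (w i).val := by
  rw [← hW, digit_ofDigits _ _ (by simpa using hi), List.getElem_map,
    (isPrefixOf_iff _ _).1 h i hi]
  simp only [List.mem_map]
  rintro x ⟨y, -, rfl⟩
  omega

theorem digit_pCode {i : ℕ} (hi : i < 1897) : digit pCode i = (p i).val :=
  digit_eq_of_isPrefixOf (by norm_num) (iterate_phi_isPrefixOf_p 13) ofDigits_iterate_phi
    (by rwa [show ((applyMor phi)^[13] [0]).length = 1897 by decide +kernel])

theorem digit_muCode {i : ℕ} (hi : i < 1374) : digit muCode i = (muP i).val := by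
  have h := isImage_mu_phiIter 10 1
  have h1 : applyMor (fun a => applyMor mu (phiIter 10 a)) (factorAt p 0 1)
      = applyMor mu ((applyMor phi)^[10] [0]) := by
    decide +kernel
  rw [h1] at h
  exact digit_eq_of_isPrefixOf (by norm_num) h ofDigits_applyMor_mu
    (by rwa [show (applyMor mu ((applyMor phi)^[10] [0])).length = 1374 by decide +kernel])

/-! ### Occurrences of letters in `p` -/

/-- The number of occurrences of the letter `c` in `p₀ ⋯ pₙ₋₁`. -/
def letterCount (c : Fin 3) (n : ℕ) : ℕ := Nat.count (fun i => p i = c) n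

theorem letterCount_succ (c : Fin 3) (n : ℕ) :
    letterCount c (n + 1) = letterCount c n + if p n = c then 1 else 0 :=
  Nat.count_succ _ _

theorem letterCount_mono (c : Fin 3) : Monotone (letterCount c) :=
  Nat.count_monotone _

theorem letterCount_sum (n : ℕ) :
    letterCount 0 n + letterCount 1 n + letterCount 2 n = n := by
  induction n with
  | zero => simp [letterCount]
  | succ n ih =>
    simp only [letterCount_succ]
    generalize p n = a
    fin_cases a <;> simp <;> omega

theorem letterCount_add_congr {k t n : ℕ} (h : ∀ i < n, p (k + i) = p (t + i)) (c : Fin 3) :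
    letterCount c (k + n) + letterCount c t = letterCount c (t + n) + letterCount c k := by
  induction n with
  | zero => simp [Nat.add_comm]
  | succ n ih =>
    have := ih fun i hi => h i (by omega)
    have hn := h n (by omega)
    rw [← Nat.add_assoc, ← Nat.add_assoc, letterCount_succ, letterCount_succ, hn]
    omega

theorem digitCount_pCode (c : Fin 3) {t n : ℕ} (h : t + n ≤ 1897) :
    letterCount c t + digitCount pCode c t n = letterCount c (t + n) := by
  induction n with
  | zero => simp [digitCount]
  | succ n ih =>
    have := ih (by omega)
    have h1 : digit pCode (Nat.add t n) = (p (t + n)).val :=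
      digit_pCode (i := t + n) (by omega)
    rw [← Nat.add_assoc, letterCount_succ, digitCount, h1, ← this, Nat.add_assoc]
    simp only [Bool.cond_eq_ite, Nat.beq_eq, Fin.ext_iff]

theorem digitCount_pCode_of_window (c : Fin 3) {k t n N : ℕ}
    (h : ∀ i < N, p (k + i) = p (t + i)) (hn : n ≤ N) (ht : t + n ≤ 1897) :
    letterCount c k + digitCount pCode c t n = letterCount c (k + n) := by
  have h1 := letterCount_add_congr (n := n) (fun i hi => h i (by omega)) c
  have h2 := digitCount_pCode c ht
  omega

theorem letterCount_add_two_le (c : Fin 3) (k : ℕ) :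
    letterCount c k + 2 ≤ letterCount c (k + 9) := by
  obtain ⟨t, ht, h⟩ := exists_window_p_five k
  have h1 := allBelow_eq_true (allBelow_eq_true two_le_digitCount_pCode t ht) c c.isLt
  have h2 := digitCount_pCode_of_window c h (n := 9) (by norm_num) (by omega)
  have h3 := Nat.le_of_ble_eq_true h1
  omega

/-! ### Repetitions -/

/-- The factor of length `q + m` at position `j` of `w` has period `q`. -/
def HasRepetition {α : Type*} (w : ℕ → α) (j q m : ℕ) : Prop :=
  ∀ i < m, w (j + i) = w (j + q + i)

/-- A repetition cannot run past the first mismatch, so its `m` is at most the tested `m'`. Carrying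
the tested bound from `m'` down to `m` is left to monotonicity in each application. -/
theorem HasRepetition.exists_test {n : ℕ} {w : ℕ → Fin n} {W j t q m N fuel len : ℕ}
    (hr : HasRepetition w j q m) (hw : ∀ i < N, w (j + i) = w (t + i))
    (hW : ∀ i < len, digit W i = (w i).val) (hN : q + fuel ≤ N) (hlen : t + N ≤ len)
    {P : ℕ → Bool} (hP : testAtMismatch W t q P fuel 0 = true) :
    ∃ m', m ≤ m' ∧ m' < fuel ∧ P m' = true := by
  obtain ⟨m', h1, h2, h3⟩ := testAtMismatch_eq_true hP
  refine ⟨m', ?_, by omega, h3⟩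
  by_contra hlt
  have h4 := hr m' (by omega)
  rw [hw m' (by omega), Nat.add_assoc j, hw (q + m') (by omega), ← Nat.add_assoc t] at h4
  rw [hW _ (by omega), hW _ (by omega), h4] at h2
  exact h2 rfl

/-- The length of the image of `p₀ ⋯ pₙ₋₁` under `μ ∘ φ`. -/
def weight (n : ℕ) : ℕ := 10 * letterCount 0 n + 5 * letterCount 1 n + 6 * letterCount 2 n

theorem digitWeight_pCode_of_window {k t n N : ℕ}
    (h : ∀ i < N, p (k + i) = p (t + i)) (hn : n ≤ N) (ht : t + n ≤ 1897) :
    weight k + digitWeight pCode t n = weight (k + n) := by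
  have h0 := digitCount_pCode_of_window 0 h hn ht
  have h1 := digitCount_pCode_of_window 1 h hn ht
  have h2 := digitCount_pCode_of_window 2 h hn ht
  simp only [Fin.val_zero, Fin.val_one, Fin.val_two] at h0 h1 h2
  simp only [weight, digitWeight]
  omega

theorem weight_mono : Monotone weight := by
  intro m n h
  have h0 := letterCount_mono 0 h
  have h1 := letterCount_mono 1 h
  have h2 := letterCount_mono 2 h
  simp only [weight]
  omega

theorem add_five_mul_le_weight (k n : ℕ) : weight k + 5 * n ≤ weight (k + n) := by
  have h0 := letterCount_mono 0 (Nat.le_add_right k n)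
  have h2 := letterCount_mono 2 (Nat.le_add_right k n)
  have h3 := letterCount_sum k
  have h4 := letterCount_sum (k + n)
  simp only [weight]
  omega

theorem HasRepetition.short_bound {j q m : ℕ} (h : HasRepetition p j q m) (hq : 0 < q)
    (hq' : q < 38) : weight (j + q) < weight j + 48 ∨
      11 * weight (j + m) + 132 + 6 * weight j ≤ 17 * weight (j + q) := by
  obtain ⟨t, ht, hw⟩ := exists_window_p_nine j
  have h1 := allBelow_eq_true (allBelow_eq_true shortBound_pCode t ht) (q - 1) (by omega)
  rw [Nat.sub_add_cancel hq] at h1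
  obtain ⟨m', hm, hm', hP⟩ := h.exists_test hw (len := 1897) (fun i hi => digit_pCode hi)
    (by omega) (by omega) h1
  have hmw := weight_mono (Nat.add_le_add_left hm j)
  have hmq := digitWeight_pCode_of_window hw (n := q) (by omega) (by omega)
  have hmm := digitWeight_pCode_of_window hw (n := m') (by omega) (by omega)
  simp only [shortBound, Bool.or_eq_true, Bool.and_eq_true, Nat.ble_eq, Nat.blt, Nat.succ_le_iff]
    at hP
  -- When `m ≤ q` and `q ≥ 5`, the image of the period has length at least 25, and `6 * 25 ≥ 11 *
  -- 12` suffices.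
  rcases hP with (⟨h5, h6⟩ | h5) | h5
  · have h7 := weight_mono (Nat.add_le_add_left h6 j)
    have h8 := add_five_mul_le_weight j q
    omega
  · omega
  · omega

/-- Nine consecutive letters contain `c` at least twice, and `6 * 2 ≥ 11`. -/
theorem letterCount_bound_of_le {j q m : ℕ} (hq : 9 ≤ q) (hm : m ≤ q) (c : Fin 3) :
    11 * letterCount c (j + m) + 11 + 6 * letterCount c j ≤ 17 * letterCount c (j + q) := by
  have h1 := letterCount_add_two_le c j
  have h2 := letterCount_mono c (Nat.add_le_add_left hq j)
  have h3 := letterCount_mono c (Nat.add_le_add_left hm j)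
  omega

theorem HasRepetition.bound_of_lt {j q m : ℕ} (h : HasRepetition p j q m) (hq : 38 ≤ q)
    (hq' : q < 76) (c : Fin 3) :
    11 * letterCount c (j + m) + 11 + 6 * letterCount c j ≤ 17 * letterCount c (j + q) := by
  obtain ⟨t, ht, hw⟩ := exists_window_p_ten j
  have h1 := allBelow_eq_true (allBelow_eq_true longBound_pCode t ht) (q - 38) (by omega)
  rw [Nat.sub_add_cancel hq] at h1
  obtain ⟨m', hm, hm', hP⟩ := h.exists_test hw (len := 1897) (fun i hi => digit_pCode hi)
    (by omega) (by omega) h1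
  simp only [longBound, Bool.or_eq_true, Nat.ble_eq] at hP
  rcases hP with h5 | h5
  · exact letterCount_bound_of_le (by omega) (hm.trans h5) c
  · have h6 := Nat.le_of_ble_eq_true (allBelow_eq_true h5 c c.isLt)
    have hmw := letterCount_mono c (Nat.add_le_add_left hm j)
    have hmq := digitCount_pCode_of_window c hw (n := q) (by omega) (by omega)
    have hmm := digitCount_pCode_of_window c hw (n := m') (by omega) (by omega)
    omega

theorem HasRepetition.muP_bound_of_lt {k q m : ℕ} (h : HasRepetition muP k q m) (hq : 0 < q)
    (hq' : q < 48) : 11 * m ≤ 17 * q := by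
  obtain ⟨t, ht, hw⟩ := exists_window_muP k
  have h1 := allBelow_eq_true (allBelow_eq_true bound_muCode t ht) (q - 1) (by omega)
  rw [Nat.sub_add_cancel hq] at h1
  obtain ⟨m', hm, hm', hP⟩ := h.exists_test hw (len := 1374) (fun i hi => digit_muCode hi)
    (by omega) (by omega) h1
  have := Nat.le_of_ble_eq_true hP
  omega

/-! ### Desubstitution of repetitions -/

theorem HasRepetition.succ {α : Type*} {w : ℕ → α} {j q m : ℕ} (h : HasRepetition w j q m)
    (hm : w (j + m) = w (j + q + m)) : HasRepetition w j q (m + 1) := by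
  intro i hi
  rcases Nat.lt_succ_iff_lt_or_eq.mp hi with h1 | rfl
  · exact h i h1
  · exact hm

theorem start_add_le {α β : Type*} {χ : α → List β} (hχ : ∀ a, χ a ≠ []) (u : ℕ → α) (k n : ℕ) :
    start χ u k + n ≤ start χ u (k + n) := by
  induction n with
  | zero => simp
  | succ n ih =>
    have := start_strictMono hχ u (Nat.lt_succ_self (k + n))
    rw [Nat.succ_eq_add_one, Nat.add_assoc] at this
    omega

theorem fin_three_cases (a : Fin 3) : a = 0 ∨ a = 1 ∨ a = 2 := by
  revert a
  decide

/-- If the first `n` letters from the start of an image on determine the letter it comes from, then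
a repetition that starts with an image stems from a repetition in the preimage. -/
theorem HasRepetition.desubstitute {α β : Type*} {χ : α → List β} {u : ℕ → α} {w : ℕ → β}
    (hχ : ∀ a, χ a ≠ []) {n : ℕ} (hn : 0 < n)
    (hdec : ∀ k k', (∀ i < n, w (start χ u k + i) = w (start χ u k' + i)) → u k = u k')
    {j q q' m : ℕ} (h : HasRepetition w (start χ u j) q m)
    (hq : start χ u j + q = start χ u (j + q')) :
    ∃ m', HasRepetition u j q' m' ∧ start χ u j + m < start χ u (j + m') + n ∧
      start χ u (j + m') + q = start χ u (j + q' + m') := by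
  by_contra hcon
  push Not at hcon
  -- If no `m'` were a stopping point, decoding letter by letter could go on forever, past the end
  -- of the given repetition.
  have key : ∀ m', HasRepetition u j q' m' ∧
      start χ u (j + m') + q = start χ u (j + q' + m') := by
    intro m'
    induction m' with
    | zero => exact ⟨fun i hi => absurd hi (by omega), hq⟩
    | succ m' ih =>
      obtain ⟨h1, h2⟩ := ih
      have h3 : start χ u (j + m') + n ≤ start χ u j + m := by
        by_contra hlt
        exact hcon m' h1 (by omega) h2
      have h4 : u (j + m') = u (j + q' + m') := by
        apply hdec
        intro i hi
        obtain ⟨d, hd⟩ := Nat.exists_eq_add_of_le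
          ((start_strictMono hχ u).monotone (Nat.le_add_right j m'))
        have h5 := h (d + i) (by omega)
        rw [← h2, hd, Nat.add_assoc _ d i, h5]
        congr 1
        omega
      refine ⟨h1.succ h4, ?_⟩
      rw [← Nat.add_assoc, ← Nat.add_assoc, start_succ, start_succ, ← h4, ← h2]
      omega
  obtain ⟨h1, h2⟩ := key m
  refine hcon m h1 ?_ h2
  have := start_add_le hχ u j m
  omega

/-! ### Synchronization of `φ` and the letterwise bound in `p` -/

theorem p_start_eq_phi_getElem? (k : ℕ) {i : ℕ} (hi : i < 2) :
    (phi (p k) ++ phi (p (k + 1)))[i]? = some (p (start phi p k + i)) := by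
  have hlen : ∀ a, 1 ≤ (phi a).length := by decide
  have h1 := hlen (p k)
  have h2 := hlen (p (k + 1))
  have h3 : i < (phi (p k) ++ phi (p (k + 1))).length := by rw [List.length_append]; omega
  rw [List.getElem?_eq_getElem h3, isImage_phi_p.apply_start_add_pair k h3]

theorem p_ne_one_iff (t : ℕ) : p t ≠ 1 ↔ ∃ k, t = start phi p k := by
  constructor
  · intro h
    obtain ⟨k, h1, h2⟩ := exists_start_le_lt phi_ne_nil p t
    obtain ⟨r, rfl⟩ := Nat.exists_eq_add_of_le h1
    rw [start_succ] at h2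
    have key : ∀ a : Fin 3, ∀ r : ℕ, (hr : r < (phi a).length) → (phi a)[r] ≠ 1 → r = 0 := by
      decide
    have hr : r < (phi (p k)).length := by omega
    rw [isImage_phi_p.apply_start_add k hr] at h
    exact ⟨k, by rw [key _ _ hr h, Nat.add_zero]⟩
  · rintro ⟨k, rfl⟩
    have key : ∀ a b : Fin 3, (phi a ++ phi b)[0]? ≠ some 1 := by decide
    have h := key (p k) (p (k + 1))
    rw [p_start_eq_phi_getElem? k (by norm_num)] at h
    exact fun h1 => h (by rw [Nat.add_zero, h1])

/-- The blocks `01`, `21`, `0` are told apart by two letters because a lone `0` is followed by the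
start of a block, which is never `1`. -/
theorem p_eq_of_start_eq {k k' : ℕ}
    (h : ∀ i < 2, p (start phi p k + i) = p (start phi p k' + i)) : p k = p k' := by
  have key : ∀ a b a' b' : Fin 3, (phi a ++ phi b)[0]? = (phi a' ++ phi b')[0]? →
      (phi a ++ phi b)[1]? = (phi a' ++ phi b')[1]? → a = a' := by decide
  apply key (p k) (p (k + 1)) (p k') (p (k' + 1)) <;>
  rw [p_start_eq_phi_getElem? _ (by norm_num), p_start_eq_phi_getElem? _ (by norm_num),
    h _ (by norm_num)]

theorem p_eq_one_of_start_eq_two {k : ℕ} (h : p (start phi p k) = 2) : p k = 1 := by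
  have key : ∀ a b : Fin 3, (phi a ++ phi b)[0]? = some 2 → a = 1 := by decide
  apply key _ (p (k + 1))
  rw [p_start_eq_phi_getElem? k (by norm_num), Nat.add_zero, h]

theorem p_ne_one_or (t : ℕ) : p t ≠ 1 ∨ p (t + 1) ≠ 1 := by
  have h := p_pair_mem t
  by_contra! h1
  rw [h1.1, h1.2] at h
  revert h
  decide

theorem letterCount_start (k : ℕ) :
    letterCount 0 (start phi p k) = letterCount 0 k + letterCount 2 k ∧
    letterCount 1 (start phi p k) = letterCount 0 k + letterCount 1 k ∧
    letterCount 2 (start phi p k) = letterCount 1 k := by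
  induction k with
  | zero => simp [letterCount]
  | succ k ih =>
    have h0 := @IsImage.apply_start_add _ _ _ _ _ isImage_phi_p k 0
    have h1 := @IsImage.apply_start_add _ _ _ _ _ isImage_phi_p k 1
    rw [start_succ]
    simp only [letterCount_succ]
    generalize p k = a at *
    rcases fin_three_cases a with rfl | rfl | rfl
    · have h0 := h0 (by decide)
      have h1 := h1 (by decide)
      simp only [phi, List.length_cons, List.length_nil, ← Nat.add_assoc, letterCount_succ,
        Nat.add_zero] at h0 h1 ⊢
      simp [h0, h1]
      omega
    · have h0 := h0 (by decide)
      have h1 := h1 (by decide)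
      simp only [phi, List.length_cons, List.length_nil, ← Nat.add_assoc, letterCount_succ,
        Nat.add_zero] at h0 h1 ⊢
      simp [h0, h1]
      omega
    · have h0 := h0 (by decide)
      simp only [phi, List.length_cons, List.length_nil, ← Nat.add_assoc, letterCount_succ,
        Nat.add_zero] at h0 ⊢
      simp [h0]
      omega

/-- Two letters decode a block, so at most one letter is left over at the right end. A leftover `2`
already determines the block `21`, so only a leftover `0` is ambiguous. -/
theorem HasRepetition.desubstitute_phi {j q m : ℕ} (h : HasRepetition p (start phi p j) q m)
    (hm : 0 < m) :
    ∃ q' m', start phi p j + q = start phi p (j + q') ∧ HasRepetition p j q' m' ∧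
      (start phi p j + m ≤ start phi p (j + m') ∨
        start phi p j + m = start phi p (j + m') + 1 ∧ p (start phi p (j + m')) = 0) := by
  have h0 := h 0 hm
  rw [Nat.add_zero, Nat.add_zero] at h0
  obtain ⟨l, hl⟩ := (p_ne_one_iff _).1 (h0 ▸ (p_ne_one_iff _).2 ⟨j, rfl⟩)
  have hjl : j ≤ l := (start_strictMono phi_ne_nil p).le_iff_le.1 (by omega)
  obtain ⟨q', rfl⟩ := Nat.exists_eq_add_of_le hjl
  obtain ⟨m', h1, h2, h3⟩ := h.desubstitute phi_ne_nil (by norm_num : 0 < 2)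
    (fun k k' => p_eq_of_start_eq) hl
  rcases Nat.lt_or_ge (start phi p (j + m')) (start phi p j + m) with h4 | h4
  · have h5 : start phi p j + m = start phi p (j + m') + 1 := by omega
    have h6 := (p_ne_one_iff _).2 ⟨j + m', rfl⟩
    have h7 : p (start phi p (j + m')) = 0 ∨ p (start phi p (j + m')) = 2 := by
      generalize p (start phi p (j + m')) = a at h6
      revert a
      decide
    rcases h7 with h7 | h7
    · exact ⟨q', m', hl, h1, Or.inr ⟨h5, h7⟩⟩
    · have h8 := h (m - 1) (by omega)
      rw [show start phi p j + (m - 1) = start phi p (j + m') by omega,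
        show start phi p j + q + (m - 1) = start phi p (j + q' + m') by omega, h7] at h8
      refine ⟨q', m' + 1, hl, h1.succ ?_, Or.inl ?_⟩
      · rw [p_eq_one_of_start_eq_two h7, p_eq_one_of_start_eq_two h8.symm]
      · have := start_strictMono phi_ne_nil p (Nat.lt_succ_self (j + m'))
        simp only [Nat.succ_eq_add_one, Nat.add_assoc] at this ⊢
        omega
  · exact ⟨q', m', hl, h1, Or.inl h4⟩

/-- Under `φ` the counts of `0`, `1`, `2` become `n₀ + n₂`, `n₀ + n₁`, `n₁`, so the slacks become
22, 22, 11. A leftover `0` at the right end costs 11 of the first; the surplus for the letter `1` is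
kept for the left end. -/
theorem HasRepetition.bound_of_start {j q m : ℕ}
    (ih : ∀ q' < q, 38 ≤ q' → ∀ j m, HasRepetition p j q' m → ∀ c,
      11 * letterCount c (j + m) + 11 + 6 * letterCount c j ≤ 17 * letterCount c (j + q'))
    (h : HasRepetition p (start phi p j) q m) (hq : 76 ≤ q) (hm : 0 < m) (c : Fin 3) :
    11 * letterCount c (start phi p j + m) + (if c = 1 then 22 else 11)
      + 6 * letterCount c (start phi p j) ≤ 17 * letterCount c (start phi p j + q) := by
  obtain ⟨q', m', h1, h2, h3⟩ := h.desubstitute_phi hm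
  have h4 := fun n => letterCount_sum n
  have h5 := fun n => letterCount_start n
  have h6 := h4 j
  have h7 := h4 (j + q')
  have h8 := h4 (start phi p j)
  have h9 := h4 (start phi p (j + q'))
  have hm2 := letterCount_mono 2 (Nat.le_add_right j q')
  obtain ⟨a0, a1, a2⟩ := h5 j
  obtain ⟨b0, b1, b2⟩ := h5 (j + q')
  obtain ⟨c0, c1, c2⟩ := h5 (j + m')
  have hlow : 38 ≤ q' := by omega
  -- The preimage of the period contains letters `0` and `1`, whose images have length two.
  have hlt : q' < q := by
    have e0 := letterCount_add_two_le 0 j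
    have e1 := letterCount_add_two_le 1 j
    have e2 := letterCount_mono 0 (show j + 9 ≤ j + q' by omega)
    have e3 := letterCount_mono 1 (show j + 9 ≤ j + q' by omega)
    omega
  have i0 := ih q' hlt hlow j m' h2 0
  have i1 := ih q' hlt hlow j m' h2 1
  have i2 := ih q' hlt hlow j m' h2 2
  have hend : letterCount c (start phi p j + m)
      ≤ letterCount c (start phi p (j + m')) + if c = 0 then 1 else 0 := by
    rcases h3 with h3 | ⟨h3, h3'⟩
    · exact (letterCount_mono c h3).trans (Nat.le_add_right _ _)
    · rw [h3, letterCount_succ, h3']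
      simp only [eq_comm, le_refl]
  rw [h1]
  rcases fin_three_cases c with rfl | rfl | rfl
  · simp at hend ⊢
    omega
  · simp at hend ⊢
    omega
  · simp at hend ⊢
    omega

/-- Repetitions of period at least `38` in `p` have exponent less than `28 / 11`, with room
to spare. -/
theorem HasRepetition.bound {j q m : ℕ} (h : HasRepetition p j q m) (hq : 38 ≤ q) (c : Fin 3) :
    11 * letterCount c (j + m) + 11 + 6 * letterCount c j ≤ 17 * letterCount c (j + q) := by
  induction q using Nat.strong_induction_on generalizing j m c with
  | _ q ih =>
    rcases Nat.lt_or_ge q 76 with hq' | hq'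
    · exact h.bound_of_lt hq hq' c
    rcases Nat.lt_or_ge q m with hm | hm
    swap
    · exact letterCount_bound_of_le (by omega) hm c
    have ih' : ∀ q' < q, 38 ≤ q' → ∀ j m, HasRepetition p j q' m → ∀ c,
        11 * letterCount c (j + m) + 11 + 6 * letterCount c j ≤ 17 * letterCount c (j + q') :=
      fun q' h1 h2 j m h3 c => ih q' h1 h3 h2 c
    by_cases h1 : p j = 1
    · have h2 := (p_ne_one_or j).resolve_left (not_not_intro h1)
      obtain ⟨k, hk⟩ := (p_ne_one_iff _).1 h2
      have h3 : HasRepetition p (j + 1) q (m - 1) := by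
        intro i hi
        have := h (i + 1) (by omega)
        rw [show j + 1 + i = j + (i + 1) by omega, this]
        congr 1
        omega
      have h4 := h 0 (by omega)
      rw [Nat.add_zero, Nat.add_zero, h1] at h4
      rw [hk] at h3
      have h5 := bound_of_start ih' h3 hq' (by omega) c
      rw [← hk, show j + 1 + (m - 1) = j + m by omega, show j + 1 + q = j + q + 1 by omega,
        letterCount_succ, letterCount_succ, h1, ← h4] at h5
      -- Moving the start back over the letter `1` costs `17 - 6 = 11` for `c = 1`, which reduces
      -- the slack from 22 to the required 11.
      rcases fin_three_cases c with rfl | rfl | rfl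
      · simp at h5 ⊢
        omega
      · simp at h5 ⊢
        omega
      · simp at h5 ⊢
        omega
    · obtain ⟨k, rfl⟩ := (p_ne_one_iff _).1 h1
      have h5 := bound_of_start ih' h hq' (by omega) c
      split_ifs at h5 <;> omega

/-! ### Repetitions of `μ(p)` -/

/-- The morphism `μ ∘ φ`: `0 → 0110011001`, `1 → 01001`, `2 → 011001`. -/
def muPhi (a : Fin 3) : List (Fin 2) := applyMor mu (phi a)

theorem muPhi_ne_nil (a : Fin 3) : muPhi a ≠ [] := by
  revert a
  decide

theorem isImage_muPhi : IsImage muPhi p muP :=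
  isImage_phi_p.comp (isImage_image mu mu_ne_nil p)

theorem five_le_length_muPhi (a : Fin 3) : 5 ≤ (muPhi a).length := by
  revert a
  decide

theorem length_muPhi_le_ten (a : Fin 3) : (muPhi a).length ≤ 10 := by
  revert a
  decide

theorem start_muPhi (k : ℕ) : start muPhi p k = weight k := by
  induction k with
  | zero => simp [weight, letterCount]
  | succ k ih =>
    rw [start_succ, ih]
    simp only [weight, letterCount_succ]
    rcases fin_three_cases (p k) with h | h | h <;> rw [h] <;> simp [muPhi, phi, mu, applyMor] <;>
      omega

theorem muP_start_eq_getElem? (k : ℕ) {i : ℕ} (hi : i < (muPhi (p k)).length + 5) :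
    (muPhi (p k) ++ muPhi (p (k + 1)))[i]? = some (muP (start muPhi p k + i)) := by
  have h2 := five_le_length_muPhi (p (k + 1))
  have h3 : i < (muPhi (p k) ++ muPhi (p (k + 1))).length := by rw [List.length_append]; omega
  rw [List.getElem?_eq_getElem h3, isImage_muPhi.apply_start_add_pair k h3]

/-- The images of letters under `μ ∘ φ`, the first one excepted, start at the occurrences of `01` in
`00101`. -/
theorem exists_eq_start_iff (t : ℕ) :
    (muP t = 0 ∧ muP (t + 1) = 0 ∧ muP (t + 2) = 1 ∧ muP (t + 3) = 0 ∧ muP (t + 4) = 1) ↔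
      ∃ k, t + 3 = start muPhi p (k + 1) := by
  constructor
  · intro h
    obtain ⟨k, h1, h2⟩ := exists_start_le_lt muPhi_ne_nil p t
    obtain ⟨r, rfl⟩ := Nat.exists_eq_add_of_le h1
    rw [start_succ] at h2
    have key : ∀ a b : Fin 3, ∀ r < 10, r < (muPhi a).length ∧
        (muPhi a ++ muPhi b)[r]? = some 0 ∧ (muPhi a ++ muPhi b)[r + 1]? = some 0 ∧
        (muPhi a ++ muPhi b)[r + 2]? = some 1 ∧ (muPhi a ++ muPhi b)[r + 3]? = some 0 ∧
        (muPhi a ++ muPhi b)[r + 4]? = some 1 → r + 3 = (muPhi a).length := by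
      decide +kernel
    have hlen := length_muPhi_le_ten (p k)
    have h3 := key (p k) (p (k + 1)) r (by omega)
    simp only [muP_start_eq_getElem? k (show r < _ by omega),
      muP_start_eq_getElem? k (show r + 1 < _ by omega),
      muP_start_eq_getElem? k (show r + 2 < _ by omega),
      muP_start_eq_getElem? k (show r + 3 < _ by omega),
      muP_start_eq_getElem? k (show r + 4 < _ by omega), Option.some.injEq] at h3
    have h4 := h3 ⟨by omega, h⟩
    exact ⟨k, by rw [start_succ]; omega⟩
  · rintro ⟨k, hk⟩
    rw [start_succ] at hk
    have hlen := five_le_length_muPhi (p k)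
    obtain ⟨r, hr⟩ := Nat.exists_eq_add_of_le (show 3 ≤ (muPhi (p k)).length by omega)
    have ht : t = start muPhi p k + r := by omega
    subst ht
    have key : ∀ a b : Fin 3, ∀ r < 10, (muPhi a).length = 3 + r →
        (muPhi a ++ muPhi b)[r]? = some 0 ∧ (muPhi a ++ muPhi b)[r + 1]? = some 0 ∧
        (muPhi a ++ muPhi b)[r + 2]? = some 1 ∧ (muPhi a ++ muPhi b)[r + 3]? = some 0 ∧
        (muPhi a ++ muPhi b)[r + 4]? = some 1 := by
      decide +kernel
    have hlen' := length_muPhi_le_ten (p k)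
    have h3 := key (p k) (p (k + 1)) r (by omega) hr
    simpa only [Nat.add_assoc, muP_start_eq_getElem? k (show r < _ by omega),
      muP_start_eq_getElem? k (show r + 1 < _ by omega),
      muP_start_eq_getElem? k (show r + 2 < _ by omega),
      muP_start_eq_getElem? k (show r + 3 < _ by omega),
      muP_start_eq_getElem? k (show r + 4 < _ by omega), Option.some.injEq] using h3

/-- In `0110011001`, `01001`, `011001`, the letter at index 2 singles out the image of `1`; the
letter at index 6 separates the other two, being the first letter of the next block after `011001`.
-/
theorem p_eq_of_muP_start_eq {k k' : ℕ}
    (h : ∀ i < 7, muP (start muPhi p k + i) = muP (start muPhi p k' + i)) : p k = p k' := by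
  have key : ∀ a b a' b' : Fin 3,
      (muPhi a ++ muPhi b)[2]? = (muPhi a' ++ muPhi b')[2]? →
      (muPhi a ++ muPhi b)[6]? = (muPhi a' ++ muPhi b')[6]? → a = a' := by
    decide +kernel
  have h1 := five_le_length_muPhi (p k)
  have h2 := five_le_length_muPhi (p k')
  apply key (p k) (p (k + 1)) (p k') (p (k' + 1)) <;>
  rw [muP_start_eq_getElem? _ (by omega), muP_start_eq_getElem? _ (by omega), h _ (by norm_num)]

theorem muP_start_succ_sub_five (k : ℕ) :
    muP (start muPhi p (k + 1) - 5) = if p k = 1 then 0 else 1 := by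
  have h5 := five_le_length_muPhi (p k)
  rw [start_succ, Nat.add_sub_assoc h5, isImage_muPhi.apply_start_add k (by omega)]
  have key : ∀ a, (muPhi a)[(muPhi a).length - 5]? = some (if a = 1 then 0 else 1) := by decide
  exact (List.getElem?_eq_some_iff.1 (key _)).2

theorem muP_start_succ_sub_seven {k : ℕ} (hk : p k ≠ 1) :
    muP (start muPhi p (k + 1) - 7) = if p k = 0 then 0 else 1 := by
  rcases fin_three_cases (p k) with h | h | h
  · have key : ∀ b, (muPhi 0 ++ muPhi b)[3]? = some 0 := by decide
    have h3 := muP_start_eq_getElem? k (i := 3) (by omega)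
    rw [h, key, Option.some.injEq] at h3
    rw [if_pos h, start_succ, h, h3]
    rfl
  · exact absurd h hk
  · obtain _ | l := k
    · exact absurd h (by decide)
    have h5 := five_le_length_muPhi (p l)
    rw [start_succ, h, show (muPhi 2).length = 6 from rfl, start_succ,
      show start muPhi p l + (muPhi (p l)).length + 6 - 7
        = start muPhi p l + ((muPhi (p l)).length - 1) by omega,
      isImage_muPhi.apply_start_add l (by omega)]
    have key : ∀ a, (muPhi a)[(muPhi a).length - 1]? = some 1 := by decide
    exact (List.getElem?_eq_some_iff.1 (key _)).2

/-- Decoding from the right: the fifth letter from the end singles out the image of `1`, and the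
seventh separates the other two, falling into the preceding block when the block is `011001`. -/
theorem p_eq_of_muP_start_succ_sub_eq {k k' : ℕ}
    (h5 : muP (start muPhi p (k + 1) - 5) = muP (start muPhi p (k' + 1) - 5))
    (h7 : muP (start muPhi p (k + 1) - 7) = muP (start muPhi p (k' + 1) - 7)) : p k = p k' := by
  rw [muP_start_succ_sub_five, muP_start_succ_sub_five] at h5
  rcases fin_three_cases (p k) with h | h | h <;> rcases fin_three_cases (p k') with h' | h' | h' <;>
    first
    | exact h.trans h'.symm
    | (rw [h, h'] at h5; exact absurd h5 (by decide))
    | (rw [muP_start_succ_sub_seven (by rw [h]; decide),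
        muP_start_succ_sub_seven (by rw [h']; decide), h, h'] at h7; exact absurd h7 (by decide))

/-- A repetition of `μ(p)` that starts before an image stems from a repetition of `p` that has been
extended to the left as far as possible. -/
theorem HasRepetition.extend_left {k q q' m j n : ℕ} (h : HasRepetition muP k q m)
    (hj : start muPhi p j ≤ k + m) (hq : start muPhi p j + q = start muPhi p (j + q'))
    (hp : HasRepetition p j q' n) :
    ∃ j' n', HasRepetition p j' q' n' ∧ j' + n' = j + n ∧ start muPhi p j' ≤ k + 6 ∧
      start muPhi p j' + q = start muPhi p (j' + q') := by
  induction j generalizing n with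
  | zero => exact ⟨0, n, hp, rfl, by simp, hq⟩
  | succ j ih =>
    rcases Nat.lt_or_ge (k + 6) (start muPhi p (j + 1)) with h1 | h1
    swap
    · exact ⟨j + 1, n, hp, rfl, h1, hq⟩
    rw [show j + 1 + q' = j + q' + 1 by omega] at hq
    -- The boundary lies at least 7 letters after `k`, so all letters needed to decode the previous
    -- block belong to the repetition.
    have key : ∀ s, 0 < s → s ≤ 7 →
        muP (start muPhi p (j + 1) - s) = muP (start muPhi p (j + q' + 1) - s) := by
      intro s hs hs'
      have := h (start muPhi p (j + 1) - s - k) (by omega)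
      rw [← hq]
      convert this using 2 <;> omega
    have h2 := p_eq_of_muP_start_succ_sub_eq (key 5 (by norm_num) (by norm_num))
      (key 7 (by norm_num) (by norm_num))
    have h3 : start muPhi p j + q = start muPhi p (j + q') := by
      rw [start_succ, start_succ, ← h2] at hq
      omega
    have h4 : HasRepetition p j q' (n + 1) := by
      intro i hi
      obtain _ | i := i
      · exact h2
      · have := hp i (by omega)
        rw [show j + (i + 1) = j + 1 + i by omega, this]
        congr 1
        omega
    have h5 := start_strictMono muPhi_ne_nil p (Nat.lt_succ_self j)
    rw [Nat.succ_eq_add_one] at h5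
    obtain ⟨j', n', e1, e2, e3⟩ := ih (by omega) h3 h4
    exact ⟨j', n', e1, by omega, e3⟩

theorem HasRepetition.muP_desubstitute {k q m : ℕ} (h : HasRepetition muP k q m) (hq : 0 < q)
    (hm : 20 ≤ m) :
    ∃ j q' n, 0 < q' ∧ HasRepetition p j q' n ∧ weight j + q = weight (j + q') ∧
      m + weight j ≤ weight (j + n) + 12 := by
  -- The shift by 2 puts the next boundary at `k + 3` or later, so its marker `00101`, which begins
  -- 3 letters earlier, lies within the repetition.
  obtain ⟨i, h1, h2⟩ := exists_start_le_lt muPhi_ne_nil p (k + 2)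
  have h3 : start muPhi p (i + 1) ≤ k + 12 := by
    have := length_muPhi_le_ten (p i)
    rw [start_succ]
    omega
  obtain ⟨t, ht⟩ := Nat.exists_eq_add_of_lt h2
  have h4 := (exists_eq_start_iff (k + t)).2 ⟨i, by omega⟩
  have h5 : ∃ l, k + q + t + 3 = start muPhi p (l + 1) := by
    rw [← exists_eq_start_iff]
    rw [h t (by omega), Nat.add_assoc k t, Nat.add_assoc k t, Nat.add_assoc k t, Nat.add_assoc k t,
      h (t + 1) (by omega), h (t + 2) (by omega), h (t + 3) (by omega), h (t + 4) (by omega)] at h4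
    exact h4
  obtain ⟨l, hl⟩ := h5
  have hmono := start_strictMono muPhi_ne_nil p
  have hil : i + 1 < l + 1 := hmono.lt_iff_lt.1 (by omega)
  obtain ⟨q', hq'⟩ := Nat.exists_eq_add_of_le hil.le
  rw [hq'] at hl
  have h6 : HasRepetition muP (start muPhi p (i + 1)) q (m - (t + 3)) := by
    intro s hs
    have := h (t + 3 + s) (by omega)
    convert this using 2 <;> omega
  have h7 : start muPhi p (i + 1) + q = start muPhi p (i + 1 + q') := by omega
  obtain ⟨n, e1, e2, -⟩ := h6.desubstitute muPhi_ne_nil (by norm_num : 0 < 7)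
    (fun _ _ => p_eq_of_muP_start_eq) h7
  obtain ⟨j, n', f1, f2, f3, f4⟩ := h.extend_left (by omega) h7 e1
  refine ⟨j, q', n', by omega, f1, ?_, ?_⟩
  · rw [← start_muPhi, ← start_muPhi, f4]
  -- The 12 lost letters: at most 6 at each end, since 7 letters always allow another block to be
  -- decoded.
  · rw [← start_muPhi, ← start_muPhi, f2]
    omega

theorem HasRepetition.muP_bound {k q m : ℕ} (h : HasRepetition muP k q m) (hq : 0 < q) :
    11 * m ≤ 17 * q := by
  rcases Nat.lt_or_ge q 48 with hq' | hq'
  · exact h.muP_bound_of_lt hq hq'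
  rcases Nat.lt_or_ge m 20 with hm | hm
  · omega
  obtain ⟨j, q', n, h1, h2, h3, h4⟩ := h.muP_desubstitute hq hm
  rcases Nat.lt_or_ge q' 38 with h5 | h5
  · have := h2.short_bound h1 h5
    omega
  -- Weighted by the image lengths 10, 5, 6, the three letterwise slacks give `11 * 21`, more than
  -- the `11 * 12` needed.
  · have e0 := h2.bound h5 0
    have e1 := h2.bound h5 1
    have e2 := h2.bound h5 2
    simp only [weight] at h3 h4
    omega

/-! ### The critical exponent -/

theorem hasRepetition_of_isPower {α : Type*} {w : ℕ → α} {u v : List α} {hu : u ≠ []} {e : ℚ}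
    (hp : IsPower v u hu e) {k : ℕ} (hk : v = factorAt w k v.length) :
    HasRepetition w k u.length (v.length - u.length) := by
  have h1 := (isPrefixOf_iff _ _).1 hp.1
  have h2 : ∀ i (hi : i < v.length), w (k + i) = u[i % u.length]'(Nat.mod_lt _
      (List.length_pos_iff.mpr hu)) := by
    intro i hi
    have h3 : v[i] = w (k + i) := by
      rw [List.getElem_of_eq hk hi]
      simp [factorAt]
    rw [← h3, h1 i hi]
    rfl
  intro i hi
  rw [Nat.add_assoc, h2 i (by omega), h2 (u.length + i) (by omega)]
  simp

theorem exponent_le_of_isPower {u v : List (Fin 2)} {hu : u ≠ []} {e : ℚ}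
    (hp : IsPower v u hu e) (hv : IsFactor v muP) : e ≤ 28 / 11 := by
  obtain ⟨k, hk⟩ := hv
  have hpos := List.length_pos_iff.mpr hu
  have h1 := (hasRepetition_of_isPower hp hk).muP_bound hpos
  have h2 : 11 * v.length ≤ 28 * u.length := by omega
  have h3 : (0 : ℚ) < u.length := by exact_mod_cast hpos
  rw [hp.2, div_le_div_iff₀ h3 (by norm_num)]
  have h4 : (11 : ℚ) * v.length ≤ 28 * u.length := by exact_mod_cast h2
  linarith

theorem factorAt_muP (k n : ℕ) (h : k + n ≤ 1374) :
    (factorAt muP k n).map Fin.val = (List.range n).map fun i => digit muCode (k + i) := by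
  simp only [factorAt, List.map_map]
  refine List.map_congr_left fun i hi => ?_
  rw [List.mem_range] at hi
  exact (digit_muCode (by omega)).symm

theorem isPower_twenty_eight_eleven :
    ∃ (u : List (Fin 2)) (hu : u ≠ []) (v : List (Fin 2)),
      IsPower v u hu (28 / 11) ∧ IsFactor v muP := by
  have h1 : (factorAt muP 4 28).map Fin.val = ([0, 1, 1, 0, 0, 1, 0, 1, 0, 0, 1, 0, 1, 1, 0, 0, 1,
      0, 1, 0, 0, 1, 0, 1, 1, 0, 0, 1] : List (Fin 2)).map Fin.val := by
    rw [factorAt_muP 4 28 (by norm_num)]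
    decide +kernel
  have h2 := (Fin.val_injective.list_map) h1
  -- The period is `μ(021)`. The factor is the suffix `01` of `μ(0)` followed by `μ(1210210)`; as
  -- `01 μ(1) = μ(0)`, it equals `μ(0210210)`, of length `11 + 11 + 6`.
  refine ⟨[0, 1, 1, 0, 0, 1, 0, 1, 0, 0, 1], by simp, factorAt muP 4 28, ⟨?_, ?_⟩, 4, ?_⟩
  · rw [h2]
    unfold IsPrefixOf
    decide +kernel
  · rw [h2]
    norm_num
  · rw [h2]
    exact h2.symm

end InfWord

theorem mainTheorem4 :
    InfWord.criticalExponent (InfWord.image InfWord.mu InfWord.mu_ne_nil InfWord.p)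
      = ((28 / 11 : ℝ) : EReal) := by
  apply le_antisymm
  · refine sSup_le ?_
    rintro x ⟨e, rfl, u, hu, v, hp, hv⟩
    have h := InfWord.exponent_le_of_isPower hp hv
    have h' : (e : ℝ) ≤ ((28 / 11 : ℚ) : ℝ) := by exact_mod_cast h
    rw [EReal.coe_le_coe_iff]
    simpa using h'
  · obtain ⟨u, hu, v, hp, hv⟩ := InfWord.isPower_twenty_eight_eleven
    exact le_sSup ⟨28 / 11, by simp, u, hu, v, hp, hv⟩
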